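/- Let $(\Omega,\mathcal F,P)$ be a probability space and let $(\varepsilon_i)_{i\ge1}$ be independent, square-integrable real random variables with $E\varepsilon_i=0$ and $E\varepsilon_i^2=1$ for all $i$. Let $b=(b_i)_{i\ge1}\in\ell_2$, and assume $P(\varepsilon_i>b_i)>0$ and $P(\varepsilon_i<b_i)>0$ for every $i$, and $\sup_i E|\varepsilon_i|^3<\infty$. For $h\in\ell_2$ put $\langle h,\varepsilon-b\rangle:=\lim_{n\to\infty}\sum_{i=1}^n h_i(\varepsilon_i-b_i)$, the limit being taken in $L^2(P)$, and for $x\in\mathbb R$ put $V^{x,h}:=x+\langle h,\varepsilon-b\rangle$. Let $U:\mathbb R\to\mathbb R$ be concave, strictly increasing and differentiable, and let $x_0\in\mathbb R$ be such that $U(x_0)=0$ and $U'(x_0)=1$. Assume that there are constants $C_1,C_3\in(0,\infty)$, $C_2,C_4\in[0,\infty)$, $\beta>1$ and $\gamma\ge\min(\beta,2)$ such that $$|U(y)|\ge C_1|y|^\beta-C_2\quad\text{for all }y\le x_0,\qquad U^-(y)\le C_3|y|^\gamma+C_4\quad\text{for all }y\in\mathbb R,$$ and $\sup_i E|\varepsilon_i|^\gamma<\infty$.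 Here $U^-=\max(-U,0)$. Let $G$ be a real random variable with $G\ge0$ a.s. and such that $U(y-G)$ is integrable for every $y\in\mathbb R$. For $x\in\mathbb R$ let $\mathcal A(U,G,x):=\{h\in\ell_2: E\,U^-(V^{x,h}-G)<\infty\}$ and $$u(G,x):=\sup_{h\in\mathcal A(U,G,x)}E\,U(V^{x,h}-G).$$ Then for every $x\in\mathbb R$ there exists $h^*\in\mathcal A(U,G,x)$ such that $U(V^{x,h^*}-G)$ is integrable and $$u(G,x)=E\,U(V^{x,h^*}-G).$$ In particular $u(G,x)$ is finite. -/

import Mathlib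

open MeasureTheory ProbabilityTheory Filter Topology

namespace APT

/-- The Hilbert space of square-summable real sequences (the trading strategies). -/
abbrev ell2 : Type := lp (fun _ : ℕ => ℝ) 2

variable {Ω : Type*} [MeasurableSpace Ω] {P : Measure Ω} [IsProbabilityMeasure P]
  {ε : ℕ → Ω → ℝ}

/-- The finite sum `∑_{i < n} h_i (ε_i - b_i)`, as an element of `L²(P)`. -/
noncomputable def partialGain (hε : ∀ i, MemLp (ε i) 2 P) (b : ℕ → ℝ) (h : ell2) (n : ℕ) :
    Lp ℝ 2 P :=
  ∑ i ∈ Finset.range n, h i • ((hε i).sub (memLp_const (b i))).toLp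

/-- The infinite sum `⟨h, ε - b⟩ = ∑_i h_i (ε_i - b_i)`: the limit in `L²(P)` of its partial sums.
The limit exists for every `h` under the hypotheses of `tendsto_partialGain` below. -/
noncomputable def gain (hε : ∀ i, MemLp (ε i) 2 P) (b : ℕ → ℝ) (h : ell2) : Lp ℝ 2 P :=
  limUnder atTop (partialGain hε b h)

/-- The terminal value `V^{x,h} = x + ⟨h, ε - b⟩`. -/
noncomputable def wealth (hε : ∀ i, MemLp (ε i) 2 P) (b : ℕ → ℝ) (x : ℝ) (h : ell2) (ω : Ω) : ℝ :=
  x + gain hε b h ω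

/-- The strategies `h ∈ ℓ²` with `E U⁻(V^{x,h} - G) < ∞`. -/
def admissible (hε : ∀ i, MemLp (ε i) 2 P) (b : ℕ → ℝ) (U : ℝ → ℝ) (G : Ω → ℝ) (x : ℝ) :
    Set ell2 :=
  {h | ∫⁻ ω, ENNReal.ofReal ((U (wealth hε b x h ω - G ω))⁻) ∂P < ⊤}

/-- The expectation `E Y⁺ - E Y⁻` of a random variable, with values in `[-∞, ∞]`; it is only
used where `E Y⁻ < ∞`. -/
noncomputable def extExpectation (P : Measure Ω) (Y : Ω → ℝ) : EReal :=
  ((∫⁻ ω, ENNReal.ofReal ((Y ω)⁺) ∂P : ENNReal) : EReal) -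
    ((∫⁻ ω, ENNReal.ofReal ((Y ω)⁻) ∂P : ENNReal) : EReal)

/-- The supremum `u(G,x)` of the expected utilities `E U(V^{x,h} - G)` over admissible `h`,
taken in `[-∞, ∞]`. -/
noncomputable def maxUtility (hε : ∀ i, MemLp (ε i) 2 P) (b : ℕ → ℝ) (U : ℝ → ℝ) (G : Ω → ℝ)
    (x : ℝ) : EReal :=
  ⨆ h ∈ admissible hε b U G x, extExpectation P (fun ω => U (wealth hε b x h ω - G ω))

/-- Well-definedness of `⟨h, ε - b⟩`: for independent standardized `ε_i` and `b ∈ ℓ²`, the partial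
sums do converge in `L²(P)`. -/
theorem tendsto_partialGain (hε : ∀ i, MemLp (ε i) 2 P) (hind : iIndepFun ε P)
    (hmean : ∀ i, ∫ ω, ε i ω ∂P = 0) (hvar : ∀ i, ∫ ω, ε i ω ^ 2 ∂P = 1)
    {b : ℕ → ℝ} (hb : Memℓp b 2) (h : ell2) :
    Tendsto (partialGain hε b h) atTop (𝓝 (gain hε b h)) := by
  have hsq : ∀ c : ℕ → ℝ, Memℓp c 2 → Summable (fun i => c i ^ 2) := by
    intro c hc
    have := hc.summable (by norm_num)
    simpa using this
  have hh := hsq h (lp.memℓp h)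
  have hb2 := hsq b hb
  have horth : Orthonormal ℝ (fun i => (hε i).toLp) := by
    rw [orthonormal_iff_ite]
    intro i j
    have hin : inner ℝ (hε i).toLp (hε j).toLp = ∫ ω, ε i ω * ε j ω ∂P := by
      rw [L2.inner_def]
      apply integral_congr_ae
      filter_upwards [(hε i).coeFn_toLp, (hε j).coeFn_toLp] with ω h1 h2
      rw [h1, h2]
      simp [mul_comm]
    rw [hin]
    split_ifs with hij
    · subst hij
      rw [← hvar i]
      simp [sq]
    · have := (hind.indepFun hij).integral_mul_eq_mul_integral (hε i).1 (hε j).1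
      simp only [Pi.mul_apply] at this
      rw [this, hmean i, zero_mul]
  have s1 : Summable (fun i => h i • (hε i).toLp) := by
    have := horth.orthogonalFamily.summable_iff_norm_sq_summable (fun i => h i)
    simp only [LinearIsometry.toSpanSingleton_apply, Real.norm_eq_abs, sq_abs] at this
    exact this.2 hh
  have s2 : Summable (fun i => h i * b i) := by
    refine Summable.of_norm_bounded (hh.add hb2) (fun i => ?_)
    rw [Real.norm_eq_abs, abs_le]
    constructor <;> nlinarith [sq_nonneg (h i + b i), sq_nonneg (h i - b i), sq_nonneg (h i),
      sq_nonneg (b i)]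
  have s3 : Summable (fun i => (h i * b i) • (memLp_const (1 : ℝ) : MemLp _ 2 P).toLp) :=
    s2.smul_const _
  have s4 : Summable (fun i => h i • ((hε i).sub (memLp_const (b i))).toLp) := by
    refine (s1.sub s3).congr (fun i => ?_)
    rw [MemLp.toLp_sub (hε i) (memLp_const (b i)), smul_sub, mul_smul]
    congr 2
    rw [← MemLp.toLp_const_smul]
    congr 1
    ext ω
    simp
  exact tendsto_nhds_limUnder ⟨_, s4.hasSum.tendsto_sum_nat⟩

end APT

/-! Expected utility is a concave functional of the strategy `h`. It is upper semicontinuous on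
`ℓ²`: strategy to payoff is a continuous linear map `T` into `L²`, and Fatou applies because the
tangent line of `U` at `x₀` and `G ≥ 0` give `U (x + f - G) ≤ |f| + c`. A coercive functional with
closed convex superlevel sets attains its maximum on a Hilbert space, so only coercivity remains.

Two facts give coercivity. The growth condition with `β > 1` makes losses superlinear: `U y ≤ |y| +
k - l * y⁻` for every slope `l ≥ 0`. Arbitrage is absent uniformly: `E ⟨h, ε - b⟩⁻ ≥ α ‖h‖` for some
`α > 0`. Since `E |T h| ≤ ‖T‖ ‖h‖`, a large `l` makes the losses dominate.

For the uniform bound, far enough out the drift `b` has small `ℓ²` norm. There a centred sum with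
variance `σ²` and third absolute moment at most `K σ³` satisfies `E |S| ≥ σ / K`, half of which is
negative part, and the drift cannot cancel it. The finitely many remaining assets are added one at a
time, by independence. -/

namespace APT

/-! ### Moments of weighted sums of independent variables -/

section Moments

variable {Ω : Type*} [MeasurableSpace Ω] {P : Measure Ω} {ε : ℕ → Ω → ℝ}

/-- Second-order Taylor expansion of `|·| ^ 3` at `s`, whose second derivative is 6-Lipschitz. The
term linear in `t` is kept exact because it integrates to zero when `t` is centred and independent
of `s`. -/
theorem abs_add_pow_three_le (s t : ℝ) :
    |s + t| ^ 3 ≤ |s| ^ 3 + 3 * ((s * |s|) * t) + 3 * (|s| * t ^ 2) + |t| ^ 3 := by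
  rcases abs_cases s with ⟨hs, hs'⟩ | ⟨hs, hs'⟩ <;> rcases abs_cases t with ⟨ht, ht'⟩ | ⟨ht, ht'⟩ <;>
  rcases abs_cases (s + t) with ⟨h, h'⟩ | ⟨h, h'⟩ <;> rw [hs, ht, h]
  · nlinarith
  · nlinarith
  · nlinarith [pow_nonneg (neg_nonneg.2 ht'.le) 3]
  · nlinarith [mul_nonneg hs' (sq_nonneg (s + 3 / 2 * t)), mul_nonneg hs' (sq_nonneg t)]
  · have h0 : 0 ≤ -s := by linarith
    have h1 : 0 ≤ t - (-s) := by linarith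
    nlinarith [pow_nonneg h0 3, mul_nonneg (mul_nonneg h1 h1) h1,
      mul_nonneg (mul_nonneg h0 h0) h1, mul_nonneg (mul_nonneg h0 h1) h1]
  · nlinarith [pow_nonneg ht' 3]
  · nlinarith
  · nlinarith

theorem indepFun_sum_mul (hmeas : ∀ i, Measurable (ε i)) (hind : iIndepFun ε P) (g c : ℕ → ℝ)
    {s : Finset ℕ} {j : ℕ} (hj : j ∉ s) :
    IndepFun (fun ω => ∑ i ∈ s, g i * (ε i ω - c i)) (ε j) P := by
  -- Coordinate `j` is left untouched, so one transformed independent family contains both the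
  -- summands and `ε j`.
  have hφ : ∀ i, Measurable (fun x : ℝ => if i = j then x else g i * (x - c i)) := by
    intro i
    split_ifs <;> fun_prop
  have h := (hind.comp _ hφ).indepFun_finsetSum_of_notMem (fun i => (hφ i).comp (hmeas i)) hj
  convert h using 1
  · ext ω
    rw [Finset.sum_apply]
    refine Finset.sum_congr rfl fun i hi => ?_
    have : i ≠ j := fun h => hj (h ▸ hi)
    simp [this]
  · ext ω
    simp

theorem integrable_abs_pow_three {f : Ω → ℝ} (hf : MemLp f 3 P) :
    Integrable (fun ω => |f ω| ^ 3) P := by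
  simpa using hf.integrable_norm_pow (by norm_num)

variable [IsProbabilityMeasure P]

theorem sq_integral_abs_le {f : Ω → ℝ} (hf : MemLp f 2 P) :
    (∫ ω, |f ω| ∂P) ^ 2 ≤ ∫ ω, f ω ^ 2 ∂P := by
  have h1 : Integrable (fun ω => |f ω|) P := (hf.integrable (by norm_num)).abs
  have h2 : Integrable (fun ω => f ω ^ 2) P := hf.integrable_sq
  set m := ∫ ω, |f ω| ∂P with hm
  have h : 0 ≤ ∫ ω, (f ω ^ 2 - 2 * m * |f ω| + m ^ 2) ∂P := by
    refine integral_nonneg fun ω => ?_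
    have := sq_nonneg (|f ω| - m)
    have h3 := sq_abs (f ω)
    simp only [Pi.zero_apply]
    nlinarith
  rw [integral_add (h2.sub' (h1.const_mul _)) (integrable_const _),
    integral_sub h2 (h1.const_mul _), integral_const_mul, ← hm] at h
  simp at h
  nlinarith

theorem memLp_sum_mul {p : ENNReal} (hε : ∀ i, MemLp (ε i) p P) (g c : ℕ → ℝ) (s : Finset ℕ) :
    MemLp (fun ω => ∑ i ∈ s, g i * (ε i ω - c i)) p P :=
  memLp_finsetSum s fun i _ => ((hε i).sub (memLp_const (c i))).const_mul (g i)

/-- Keeping `σ` fixed while the index set grows makes the cubic bound additive in `g j ^ 2`: a new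
term adds at most `3 * g j ^ 2 * E |S|` and `|g j| ^ 3 * M`, where `E |S| ≤ σ` and `|g j| ≤ σ`. -/
theorem moments_sum_mul (hmeas : ∀ i, Measurable (ε i)) (h3 : ∀ i, MemLp (ε i) 3 P)
    (hind : iIndepFun ε P) (hmean : ∀ i, ∫ ω, ε i ω ∂P = 0) (hvar : ∀ i, ∫ ω, ε i ω ^ 2 ∂P = 1)
    {M : ℝ} (hM : ∀ i, ∫ ω, |ε i ω| ^ 3 ∂P ≤ M) (g : ℕ → ℝ) {σ : ℝ} (hσ : 0 ≤ σ)
    (s : Finset ℕ) (hs : ∑ i ∈ s, g i ^ 2 ≤ σ ^ 2) :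
    ∫ ω, ∑ i ∈ s, g i * ε i ω ∂P = 0 ∧
      ∫ ω, (∑ i ∈ s, g i * ε i ω) ^ 2 ∂P = ∑ i ∈ s, g i ^ 2 ∧
      ∫ ω, |∑ i ∈ s, g i * ε i ω| ^ 3 ∂P ≤ (3 + M) * σ * ∑ i ∈ s, g i ^ 2 := by
  have h2 : ∀ i, MemLp (ε i) 2 P := fun i => (h3 i).mono_exponent (by norm_num)
  have h1 : ∀ i, Integrable (ε i) P := fun i => (h2 i).integrable (by norm_num)
  have hM0 : 0 ≤ M := le_trans (integral_nonneg fun ω => by positivity) (hM 0)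
  induction s using Finset.induction_on with
  | empty => simp
  | insert j s hj ih =>
    rw [Finset.sum_insert hj] at hs
    obtain ⟨ih1, ih2, ih3⟩ := ih (by nlinarith [sq_nonneg (g j)])
    simp only [Finset.sum_insert hj]
    set S : Ω → ℝ := fun ω => ∑ i ∈ s, g i * ε i ω with hS
    have hind' : IndepFun S (ε j) P := by
      simpa using indepFun_sum_mul hmeas hind g 0 hj
    have hS3 : MemLp S 3 P := by simpa using memLp_sum_mul h3 g 0 s
    have hS2 : MemLp S 2 P := hS3.mono_exponent (by norm_num)
    have hS1 : Integrable S P := hS2.integrable (by norm_num)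
    have hSm : Measurable S := by
      rw [hS]; exact Finset.measurable_sum s fun i _ => (hmeas i).const_mul (g i)
    have i1 : ∫ ω, S ω * ε j ω ∂P = 0 := by
      have := hind'.integral_mul_eq_mul_integral hSm.aestronglyMeasurable
        (hmeas j).aestronglyMeasurable
      simp only [Pi.mul_apply] at this
      rw [this, hmean j, mul_zero]
    have j1 : Integrable (fun ω => S ω * ε j ω) P := hind'.integrable_mul hS1 (h1 j)
    have hindB : IndepFun (fun ω => S ω * |S ω|) (ε j) P :=
      hind'.comp (φ := fun x => x * |x|) (ψ := id) (by fun_prop) measurable_id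
    have hSB : Integrable (fun ω => S ω * |S ω|) P := by
      refine hS2.integrable_sq.mono (by fun_prop) (Eventually.of_forall fun ω => ?_)
      simp [sq]
    have j2 : Integrable (fun ω => (S ω * |S ω|) * ε j ω) P := hindB.integrable_mul hSB (h1 j)
    have i2 : ∫ ω, (S ω * |S ω|) * ε j ω ∂P = 0 := by
      have := hindB.integral_mul_eq_mul_integral hSB.1 (hmeas j).aestronglyMeasurable
      simp only [Pi.mul_apply] at this
      rw [this, hmean j, mul_zero]
    have hindC : IndepFun (fun ω => |S ω|) (fun ω => ε j ω ^ 2) P :=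
      hind'.comp (φ := fun x => |x|) (ψ := fun x => x ^ 2) (by fun_prop) (by fun_prop)
    have j3 : Integrable (fun ω => |S ω| * ε j ω ^ 2) P :=
      hindC.integrable_mul hS1.abs (h2 j).integrable_sq
    have i3 : ∫ ω, |S ω| * ε j ω ^ 2 ∂P ≤ σ := by
      have := hindC.integral_mul_eq_mul_integral hS1.abs.1 (h2 j).integrable_sq.1
      simp only [Pi.mul_apply] at this
      rw [this, hvar j, mul_one]
      refine le_of_sq_le_sq ((sq_integral_abs_le hS2).trans ?_) hσ
      rw [ih2]
      nlinarith [sq_nonneg (g j)]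
    have hgσ : |g j| ≤ σ := by
      refine abs_le_of_sq_le_sq ?_ hσ
      have : 0 ≤ ∑ i ∈ s, g i ^ 2 := Finset.sum_nonneg fun i _ => sq_nonneg _
      linarith
    refine ⟨?_, ?_, ?_⟩
    · rw [integral_add ((h1 j).const_mul _) hS1, integral_const_mul, hmean j, ih1]
      simp
    · change ∫ ω, (g j * ε j ω + S ω) ^ 2 ∂P = _
      have : ∀ ω, (g j * ε j ω + S ω) ^ 2
          = g j ^ 2 * ε j ω ^ 2 + 2 * g j * (S ω * ε j ω) + S ω ^ 2 := fun ω => by ring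
      simp_rw [this]
      rw [integral_add (((h2 j).integrable_sq.const_mul _).fun_add (j1.const_mul _)) hS2.integrable_sq,
        integral_add ((h2 j).integrable_sq.const_mul _) (j1.const_mul _), integral_const_mul,
        integral_const_mul, hvar j, i1, ih2]
      ring
    · have k1 := integrable_abs_pow_three hS3
      have k4 := integrable_abs_pow_three (h3 j)
      calc ∫ ω, |g j * ε j ω + S ω| ^ 3 ∂P
          ≤ ∫ ω, (|S ω| ^ 3 + 3 * g j * ((S ω * |S ω|) * ε j ω)
            + 3 * g j ^ 2 * (|S ω| * ε j ω ^ 2) + |g j| ^ 3 * |ε j ω| ^ 3) ∂P := by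
            refine integral_mono_of_nonneg (Eventually.of_forall fun ω => by positivity)
              (((k1.fun_add (j2.const_mul _)).fun_add (j3.const_mul _)).fun_add (k4.const_mul _))
              (Eventually.of_forall fun ω => ?_)
            have := abs_add_pow_three_le (S ω) (g j * ε j ω)
            rw [abs_mul] at this
            simp only
            rw [add_comm (g j * ε j ω)]
            refine this.trans (le_of_eq ?_)
            ring
        _ = ∫ ω, |S ω| ^ 3 ∂P + 3 * g j * 0 + 3 * g j ^ 2 * ∫ ω, |S ω| * ε j ω ^ 2 ∂P
            + |g j| ^ 3 * ∫ ω, |ε j ω| ^ 3 ∂P := by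
            rw [integral_add ((k1.fun_add (j2.const_mul _)).fun_add (j3.const_mul _)) (k4.const_mul _),
              integral_add (k1.fun_add (j2.const_mul _)) (j3.const_mul _),
              integral_add k1 (j2.const_mul _), integral_const_mul, integral_const_mul,
              integral_const_mul, i2]
        _ ≤ (3 + M) * σ * ∑ i ∈ s, g i ^ 2 + 3 * g j * 0 + 3 * g j ^ 2 * σ
            + (σ * g j ^ 2) * M := by
            have : |g j| ^ 3 ≤ σ * g j ^ 2 := by
              rw [pow_succ', sq_abs]
              exact mul_le_mul_of_nonneg_right hgσ (sq_nonneg _)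
            gcongr
            exact hM j
        _ = _ := by ring

/-- Integrate `|S| * (K * σ - |S|) ^ 2 ≥ 0`: second and third moments together bound the first from
below. -/
theorem le_of_abs_moments {S : Ω → ℝ} (h3 : MemLp S 3 P) {σ K : ℝ} (hσ : 0 < σ) (hK : 0 < K)
    (hS2 : ∫ ω, S ω ^ 2 ∂P = σ ^ 2) (hS3 : ∫ ω, |S ω| ^ 3 ∂P ≤ K * σ ^ 3) :
    σ / K ≤ ∫ ω, |S ω| ∂P := by
  have h2 : MemLp S 2 P := h3.mono_exponent (by norm_num)
  have i1 : Integrable (fun ω => |S ω|) P := (h2.integrable (by norm_num)).abs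
  have i3 := integrable_abs_pow_three h3
  have key : ∫ ω, 2 * (K * σ) * S ω ^ 2 ∂P ≤ ∫ ω, ((K * σ) ^ 2 * |S ω| + |S ω| ^ 3) ∂P := by
    refine integral_mono (h2.integrable_sq.const_mul _) ((i1.const_mul _).add i3) fun ω => ?_
    have := mul_nonneg (abs_nonneg (S ω)) (sq_nonneg (K * σ - |S ω|))
    simp only
    rw [← sq_abs (S ω)]
    nlinarith
  rw [integral_const_mul, hS2, integral_add (i1.const_mul _) i3, integral_const_mul] at key
  rw [div_le_iff₀ hK]
  have : K * σ ^ 2 * σ ≤ K * σ ^ 2 * ((∫ ω, |S ω| ∂P) * K) := by nlinarith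
  exact le_of_mul_le_mul_left this (by positivity)

/-- Lower bound for the negative part and the probability of a nonpositive value, for an
almost centred sum of independent standardized variables. -/
theorem negPart_sum_lower_bound (hmeas : ∀ i, Measurable (ε i)) (h3 : ∀ i, MemLp (ε i) 3 P)
    (hind : iIndepFun ε P) (hmean : ∀ i, ∫ ω, ε i ω ∂P = 0) (hvar : ∀ i, ∫ ω, ε i ω ^ 2 ∂P = 1)
    {M : ℝ} (hM : ∀ i, ∫ ω, |ε i ω| ^ 3 ∂P ≤ M) {b : ℕ → ℝ} (s : Finset ℕ)
    (hb : ∑ i ∈ s, b i ^ 2 ≤ (1 / (4 * (3 + M))) ^ 2) (g : ℕ → ℝ) :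
    1 / (4 * (3 + M)) * √(∑ i ∈ s, g i ^ 2) ≤
        ∫ ω, max (-(∑ i ∈ s, g i * (ε i ω - b i))) 0 ∂P ∧
      1 / (32 * (3 + M) ^ 2) ≤ P.real {ω | ∑ i ∈ s, g i * (ε i ω - b i) ≤ 0} := by
  have hM0 : 0 ≤ M := le_trans (integral_nonneg fun ω => by positivity) (hM 0)
  set K := 3 + M with hKdef
  have hK : 3 ≤ K := by linarith
  set σ := √(∑ i ∈ s, g i ^ 2) with hσdef
  have hsum : 0 ≤ ∑ i ∈ s, g i ^ 2 := Finset.sum_nonneg fun i _ => sq_nonneg _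
  have hσsq : σ ^ 2 = ∑ i ∈ s, g i ^ 2 := Real.sq_sqrt hsum
  have hσ0 : 0 ≤ σ := Real.sqrt_nonneg _
  rcases hσ0.eq_or_lt with hσ | hσ
  · have hg : ∀ i ∈ s, g i = 0 := by
      rw [← hσ] at hσsq
      intro i hi
      have := (Finset.sum_eq_zero_iff_of_nonneg fun i _ => sq_nonneg (g i)).1
        (by rw [← hσsq]; norm_num) i hi
      simpa using this
    have hz : ∀ ω, ∑ i ∈ s, g i * (ε i ω - b i) = 0 := fun ω =>
      Finset.sum_eq_zero fun i hi => by rw [hg i hi, zero_mul]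
    simp only [hz, ← hσ]
    simp only [mul_zero, neg_zero, max_self, integral_zero, le_refl, Set.ofPred_true, true_and]
    rw [probReal_univ, div_le_one (by positivity)]
    nlinarith
  obtain ⟨m1, m2, m3⟩ := moments_sum_mul hmeas h3 hind hmean hvar hM g hσ0 s hσsq.ge
  set S : Ω → ℝ := fun ω => ∑ i ∈ s, g i * ε i ω with hS
  have hS3 : MemLp S 3 P := by simpa using memLp_sum_mul h3 g 0 s
  have hS2 : MemLp S 2 P := hS3.mono_exponent (by norm_num)
  have hS1 : Integrable S P := hS2.integrable (by norm_num)
  have hE : σ / K ≤ ∫ ω, |S ω| ∂P := by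
    refine le_of_abs_moments hS3 hσ (by linarith) (by rw [hσsq]; exact m2) (m3.trans ?_)
    rw [← hσsq, ← hKdef]
    exact le_of_eq (by ring)
  set m := ∑ i ∈ s, g i * b i with hm
  have hmσ : |m| ≤ 1 / (4 * K) * σ := by
    refine abs_le_of_sq_le_sq ?_ (by positivity)
    calc m ^ 2 ≤ (∑ i ∈ s, g i ^ 2) * ∑ i ∈ s, b i ^ 2 := Finset.sum_mul_sq_le_sq_mul_sq _ _ _
      _ ≤ (∑ i ∈ s, g i ^ 2) * (1 / (4 * K)) ^ 2 := by gcongr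
      _ = _ := by rw [← hσsq]; ring
  have hT : ∀ ω, ∑ i ∈ s, g i * (ε i ω - b i) = S ω - m := fun ω => by
    rw [hS, hm, ← Finset.sum_sub_distrib]
    exact Finset.sum_congr rfl fun i _ => by ring
  simp only [hT]
  have hT2 : MemLp (fun ω => S ω - m) 2 P := hS2.sub (memLp_const m)
  have hT1 : Integrable (fun ω => S ω - m) P := hT2.integrable (by norm_num)
  have hneg : Integrable (fun ω => max (-(S ω - m)) 0) P := hT1.neg.pos_part
  -- As `S` is centred, its negative part has mean `E |S| / 2 ≥ σ / (2 * K)`; the drift removes at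
  -- most half of this.
  have hfirst : 1 / (4 * K) * σ ≤ ∫ ω, max (-(S ω - m)) 0 ∂P := by
    have h : ∫ ω, ((|S ω| - S ω) / 2 - |m|) ∂P ≤ ∫ ω, max (-(S ω - m)) 0 ∂P := by
      refine integral_mono (((hS1.abs.sub' hS1).div_const 2).sub (integrable_const _)) hneg
        fun ω => ?_
      simp only
      rcases abs_cases (S ω) with ⟨h, h'⟩ | ⟨h, h'⟩ <;> rw [h]
      · exact le_max_of_le_right (by linarith [abs_nonneg m])
      · exact le_max_of_le_left (by linarith [neg_abs_le m])
    rw [integral_sub ((hS1.abs.sub' hS1).div_const 2) (integrable_const _), integral_div,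
      integral_sub hS1.abs hS1, m1] at h
    simp only [sub_zero, integral_const, probReal_univ, one_smul] at h
    refine le_trans ?_ h
    have : σ / K = 4 * (1 / (4 * K) * σ) := by field_simp
    linarith
  refine ⟨hfirst, ?_⟩
  have hmS : MeasurableSet {ω | S ω - m ≤ 0} := by
    have : Measurable S := by
      rw [hS]; exact Finset.measurable_sum s fun i _ => (hmeas i).const_mul (g i)
    exact measurableSet_le (by fun_prop) measurable_const
  have hI : Integrable (fun ω => {ω | S ω - m ≤ 0}.indicator (1 : Ω → ℝ) ω) P :=
    (integrable_const (1 : ℝ)).indicator hmS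
  -- On the loss event this is `2 * a * b ≤ a ^ 2 + b ^ 2` with `a = 8 * K * σ`. The scale makes the
  -- left integral at least `4 * σ ^ 2`, while `E (S - m) ^ 2 ≤ 2 * σ ^ 2`, so the event has
  -- probability bounded below.
  have hsec : ∫ ω, 16 * K * σ * max (-(S ω - m)) 0 ∂P
      ≤ ∫ ω, ((S ω ^ 2 - 2 * m * S ω + m ^ 2)
        + (8 * K * σ) ^ 2 * {ω | S ω - m ≤ 0}.indicator 1 ω) ∂P := by
    refine integral_mono (hneg.const_mul _)
      (((hS2.integrable_sq.sub' (hS1.const_mul _)).fun_add (integrable_const _)).fun_add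
        (hI.const_mul _)) fun ω => ?_
    simp only
    by_cases h : S ω - m ≤ 0
    · rw [Set.indicator_of_mem (by exact h), max_eq_left (by linarith)]
      simp only [Pi.one_apply]
      nlinarith [sq_nonneg (8 * K * σ + (S ω - m))]
    · rw [Set.indicator_of_notMem (by exact h), max_eq_right (by linarith)]
      nlinarith [sq_nonneg (S ω - m)]
  rw [integral_const_mul, integral_add ((hS2.integrable_sq.sub' (hS1.const_mul _)).fun_add
      (integrable_const _)) (hI.const_mul _),
    integral_add (hS2.integrable_sq.sub' (hS1.const_mul _)) (integrable_const _),
    integral_sub hS2.integrable_sq (hS1.const_mul _), integral_const_mul, integral_const_mul,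
    integral_indicator_one hmS, m1, m2, ← hσsq] at hsec
  simp only [mul_zero, sub_zero, integral_const, probReal_univ, one_smul] at hsec
  have hm2 : m ^ 2 ≤ σ ^ 2 := by
    rw [← sq_abs m]
    refine pow_le_pow_left₀ (abs_nonneg m) (hmσ.trans ?_) 2
    refine mul_le_of_le_one_left hσ0 ?_
    rw [div_le_one (by positivity)]
    linarith
  have hlow : 4 * σ ^ 2 ≤ 16 * K * σ * ∫ ω, max (-(S ω - m)) 0 ∂P := by
    refine le_trans (le_of_eq ?_) (mul_le_mul_of_nonneg_left hfirst (by positivity))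
    field_simp
    ring
  rw [div_le_iff₀ (by positivity)]
  have : σ ^ 2 * 2 ≤ σ ^ 2 * (P.real {ω | S ω - m ≤ 0} * (64 * K ^ 2)) := by nlinarith
  have := le_of_mul_le_mul_left this (by positivity)
  linarith

end Moments

/-! ### Uniform absence of arbitrage for finitely many assets -/

section NoArbitrage

variable {Ω : Type*} [MeasurableSpace Ω] {P : Measure Ω}

/-- Where `Y ≤ 0`, adding `Y` can only increase the loss of `X`; independence factorizes the
expectation restricted to that event. -/
theorem integral_negPart_mul_le_of_indepFun {X Y : Ω → ℝ} (hY : Measurable Y)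
    (hXi : Integrable X P) (hYi : Integrable Y P) (hind : IndepFun X Y P) :
    (∫ ω, max (-X ω) 0 ∂P) * P.real {ω | Y ω ≤ 0} ≤ ∫ ω, max (-(X ω + Y ω)) 0 ∂P := by
  have hm : MeasurableSet {y : ℝ | y ≤ 0} := measurableSet_le measurable_id measurable_const
  have hφ : Measurable ({y : ℝ | y ≤ 0}.indicator (1 : ℝ → ℝ)) := measurable_one.indicator hm
  have hind' : IndepFun (fun ω => max (-X ω) 0) (fun ω => {y : ℝ | y ≤ 0}.indicator (1 : ℝ → ℝ) (Y ω))
      P := hind.comp (φ := fun x => max (-x) 0) (by fun_prop) hφ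
  have hprob : P.real {ω | Y ω ≤ 0} = ∫ ω, {y : ℝ | y ≤ 0}.indicator (1 : ℝ → ℝ) (Y ω) ∂P := by
    rw [← Set.preimage_ofPred_eq (f := Y) (p := fun y => y ≤ 0),
      ← integral_indicator_one (hm.preimage hY)]
    rfl
  have hmul := hind'.integral_mul_eq_mul_integral hXi.neg.pos_part.1
    (hφ.comp hY).aestronglyMeasurable
  simp only [Pi.mul_apply] at hmul
  rw [hprob]
  refine hmul.symm.trans_le (integral_mono_of_nonneg (Eventually.of_forall fun ω => ?_)
    (hXi.add hYi).neg.pos_part (Eventually.of_forall fun ω => ?_))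
  · exact mul_nonneg (le_max_right _ _) (Set.indicator_nonneg (fun _ _ => zero_le_one) _)
  · simp only
    by_cases h : Y ω ≤ 0
    · rw [Set.indicator_of_mem (by exact h), Pi.one_apply, mul_one]
      exact max_le_max (by simpa using h) le_rfl
    · rw [Set.indicator_of_notMem (by exact h), mul_zero]
      exact le_max_right _ _

variable [IsProbabilityMeasure P]

theorem prob_nonpos_mul_le_of_indepFun {X Y : Ω → ℝ} (hind : IndepFun X Y P) :
    P.real {ω | X ω ≤ 0} * P.real {ω | Y ω ≤ 0} ≤ P.real {ω | X ω + Y ω ≤ 0} := by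
  have hm : MeasurableSet {y : ℝ | y ≤ 0} := measurableSet_le measurable_id measurable_const
  have h := hind.measure_inter_preimage_eq_mul _ _ hm hm
  simp only [measureReal_def]
  rw [← ENNReal.toReal_mul]
  refine ENNReal.toReal_mono (measure_ne_top _ _) (h.symm.trans_le (measure_mono ?_))
  rintro ω ⟨h1, h2⟩
  have h1' : X ω ≤ 0 := h1
  have h2' : Y ω ≤ 0 := h2
  exact add_nonpos h1' h2'

/-- A nondegenerate loss bound for positions in a single asset that takes both signs. -/
theorem exists_single_loss_bound {X : Ω → ℝ} (hX : Integrable X P)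
    (hpos : 0 < P {ω | 0 < X ω}) (hneg : 0 < P {ω | X ω < 0}) :
    ∃ c > 0, ∃ p > 0, ∀ a : ℝ,
      c * |a| ≤ ∫ ω, max (-(a * X ω)) 0 ∂P ∧ p ≤ P.real {ω | a * X ω ≤ 0} := by
  have h1 : 0 < ∫ ω, max (-X ω) 0 ∂P := by
    refine (integral_pos_iff_support_of_nonneg (fun ω => le_max_right _ _) hX.neg.pos_part).2 ?_
    refine hneg.trans_le (measure_mono fun ω hω => ?_)
    have : X ω < 0 := hω
    simp only [Function.mem_support]
    exact (lt_max_of_lt_left (neg_pos.2 this)).ne'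
  have h2 : 0 < ∫ ω, max (X ω) 0 ∂P := by
    refine (integral_pos_iff_support_of_nonneg (fun ω => le_max_right _ _) hX.pos_part).2 ?_
    refine hpos.trans_le (measure_mono fun ω hω => ?_)
    have : 0 < X ω := hω
    simp only [Function.mem_support]
    exact (lt_max_of_lt_left this).ne'
  have h3 : 0 < P.real {ω | 0 < X ω} := ENNReal.toReal_pos hpos.ne' (measure_ne_top _ _)
  have h4 : 0 < P.real {ω | X ω < 0} := ENNReal.toReal_pos hneg.ne' (measure_ne_top _ _)
  -- The minima cover long and short positions at once.
  refine ⟨_, lt_min h1 h2, _, lt_min h3 h4, fun a => ?_⟩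
  rcases le_total 0 a with ha | ha
  · rw [abs_of_nonneg ha]
    constructor
    · have : ∀ ω, max (-(a * X ω)) 0 = max (-X ω) 0 * a := fun ω => by
        rw [max_mul_of_nonneg _ _ ha]; ring_nf
      simp_rw [this]
      rw [integral_mul_const]
      gcongr
      exact min_le_left _ _
    · refine (min_le_right _ _).trans (measureReal_mono fun ω hω => ?_)
      exact mul_nonpos_of_nonneg_of_nonpos ha (le_of_lt hω)
  · rw [abs_of_nonpos ha]
    have ha' : 0 ≤ -a := by linarith
    constructor
    · have : ∀ ω, max (-(a * X ω)) 0 = max (X ω) 0 * (-a) := fun ω => by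
        rw [max_mul_of_nonneg _ _ ha']; ring_nf
      simp_rw [this]
      rw [integral_mul_const]
      gcongr
      exact min_le_right _ _
    · refine (min_le_left _ _).trans (measureReal_mono fun ω hω => ?_)
      exact mul_nonpos_of_nonpos_of_nonneg ha (le_of_lt hω)

variable {ε : ℕ → Ω → ℝ}

/-- Uniform absence of arbitrage: the expected loss of a position in finitely many assets is at
least proportional to the size of the position. -/
theorem exists_loss_bound_finset (hmeas : ∀ i, Measurable (ε i)) (h3 : ∀ i, MemLp (ε i) 3 P)
    (hind : iIndepFun ε P) (hmean : ∀ i, ∫ ω, ε i ω ∂P = 0) (hvar : ∀ i, ∫ ω, ε i ω ^ 2 ∂P = 1)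
    {M : ℝ} (hM : ∀ i, ∫ ω, |ε i ω| ^ 3 ∂P ≤ M) {b : ℕ → ℝ} (hb : Summable fun i => b i ^ 2)
    (hNA : ∀ i, 0 < P {ω | b i < ε i ω} ∧ 0 < P {ω | ε i ω < b i}) :
    ∃ α > 0, ∀ (s : Finset ℕ) (g : ℕ → ℝ),
      α * √(∑ i ∈ s, g i ^ 2) ≤ ∫ ω, max (-(∑ i ∈ s, g i * (ε i ω - b i))) 0 ∂P := by
  have hM0 : 0 ≤ M := le_trans (integral_nonneg fun ω => by positivity) (hM 0)
  have h1 : ∀ i, Integrable (ε i) P := fun i => (h3 i).integrable (by norm_num)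
  obtain ⟨N, hN⟩ : ∃ N, ∀ s : Finset ℕ, (∀ i ∈ s, N ≤ i) →
      ∑ i ∈ s, b i ^ 2 ≤ (1 / (4 * (3 + M))) ^ 2 := by
    obtain ⟨t, ht⟩ := summable_iff_vanishing_norm.1 hb ((1 / (4 * (3 + M))) ^ 2) (by positivity)
    refine ⟨t.sup id + 1, fun s hs => ?_⟩
    refine (le_abs_self _).trans (ht s ?_).le
    rw [Finset.disjoint_left]
    intro i hi hit
    have := hs i hi
    have := Finset.le_sup (f := id) hit
    simp only [id] at this
    omega
  -- Descending induction from the small-drift tail. The lower bound `p` on the probability of no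
  -- gain is carried along because adding the next asset multiplies its expected loss by this
  -- probability.
  have key : ∀ k ≤ N, ∃ α > 0, ∃ p > 0, ∀ s : Finset ℕ, (∀ i ∈ s, k ≤ i) → ∀ g : ℕ → ℝ,
      α * √(∑ i ∈ s, g i ^ 2) ≤ ∫ ω, max (-(∑ i ∈ s, g i * (ε i ω - b i))) 0 ∂P ∧
        p ≤ P.real {ω | ∑ i ∈ s, g i * (ε i ω - b i) ≤ 0} := by
    intro k hk
    induction hk using Nat.decreasingInduction with
    | self =>
      exact ⟨_, by positivity, _, by positivity, fun s hs g =>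
        negPart_sum_lower_bound hmeas h3 hind hmean hvar hM s (hN s hs) g⟩
    | of_succ k hk ih =>
      obtain ⟨α, hα, p, hp, hαp⟩ := ih
      obtain ⟨c, hc, q, hq, hcq⟩ := exists_single_loss_bound
        (X := fun ω => ε k ω - b k) (P := P) ((h1 k).sub (integrable_const _))
        (by simpa using (hNA k).1) (by simpa using (hNA k).2)
      have hp1 : p ≤ 1 := by
        have := (hαp ∅ (by simp) 0).2
        exact this.trans measureReal_le_one
      have hq1 : q ≤ 1 := (hcq 0).2.trans measureReal_le_one
      -- The expected loss dominates both `c * p * |g k|` and `α * q * σ`, hence their average; the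
      -- norm of the enlarged position is at most `|g k| + σ`.
      refine ⟨min (c * p) (α * q) / 2, by positivity, q * p, by positivity, fun s hs g => ?_⟩
      have hmin1 : min (c * p) (α * q) ≤ c * p := min_le_left _ _
      have hmin2 : min (c * p) (α * q) ≤ α * q := min_le_right _ _
      have hmin0 : 0 < min (c * p) (α * q) := by positivity
      by_cases hks : k ∈ s
      · have hs' : ∀ i ∈ s.erase k, k + 1 ≤ i := fun i hi => by
          have := hs i (Finset.mem_of_mem_erase hi)
          have := Finset.ne_of_mem_erase hi
          omega
        obtain ⟨e1, e2⟩ := hαp _ hs' g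
        obtain ⟨f1, f2⟩ := hcq (g k)
        rw [← Finset.insert_erase hks]
        simp only [Finset.sum_insert (Finset.notMem_erase k s)]
        set X : Ω → ℝ := fun ω => g k * (ε k ω - b k) with hX
        set Y : Ω → ℝ := fun ω => ∑ i ∈ s.erase k, g i * (ε i ω - b i) with hY
        have hXm : Measurable X := ((hmeas k).sub_const _).const_mul _
        have hYm : Measurable Y := by
          rw [hY]
          exact Finset.measurable_sum _ fun i _ => ((hmeas i).sub_const _).const_mul _
        have hXi : Integrable X P := ((h1 k).sub (integrable_const _)).const_mul _
        have hYi : Integrable Y P := (memLp_sum_mul h3 g b _).integrable (by norm_num)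
        have hYX : IndepFun Y X P :=
          (indepFun_sum_mul hmeas hind g b (Finset.notMem_erase k s)).comp
            (φ := id) (ψ := fun x => g k * (x - b k)) measurable_id (by fun_prop)
        have r1 := integral_negPart_mul_le_of_indepFun hYm hXi hYi hYX.symm
        have r2 := integral_negPart_mul_le_of_indepFun hXm hYi hXi hYX
        have r3 := prob_nonpos_mul_le_of_indepFun hYX.symm
        simp only [add_comm (Y _) (X _)] at r2
        refine ⟨?_, le_trans (mul_le_mul f2 e2 hp.le (by positivity)) r3⟩
        change _ ≤ ∫ ω, max (-(X ω + Y ω)) 0 ∂P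
        set σ := √(∑ i ∈ s.erase k, g i ^ 2) with hσ
        have hσ0 : 0 ≤ σ := Real.sqrt_nonneg _
        have hsq : √(g k ^ 2 + ∑ i ∈ s.erase k, g i ^ 2) ≤ |g k| + σ := by
          refine Real.sqrt_le_iff.2 ⟨by positivity, ?_⟩
          have : σ ^ 2 = ∑ i ∈ s.erase k, g i ^ 2 :=
            Real.sq_sqrt (Finset.sum_nonneg fun i _ => sq_nonneg _)
          rw [← this]
          have := sq_abs (g k)
          nlinarith [mul_nonneg (abs_nonneg (g k)) hσ0]
        have t1 : c * |g k| * p ≤ ∫ ω, max (-(X ω + Y ω)) 0 ∂P :=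
          le_trans (mul_le_mul f1 e2 hp.le ((mul_nonneg hc.le (abs_nonneg _)).trans f1)) r1
        have t2 : α * σ * q ≤ ∫ ω, max (-(X ω + Y ω)) 0 ∂P :=
          le_trans (mul_le_mul e1 f2 hq.le ((mul_nonneg hα.le hσ0).trans e1)) r2
        have t3 := mul_le_mul_of_nonneg_left hsq hmin0.le
        have t4 := mul_le_mul_of_nonneg_right hmin1 (abs_nonneg (g k))
        have t5 := mul_le_mul_of_nonneg_right hmin2 hσ0
        linarith
      · have hs' : ∀ i ∈ s, k + 1 ≤ i := fun i hi => by
          have := hs i hi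
          have : i ≠ k := fun h => hks (h ▸ hi)
          omega
        obtain ⟨e1, e2⟩ := hαp _ hs' g
        refine ⟨le_trans (mul_le_mul_of_nonneg_right ?_ (Real.sqrt_nonneg _)) e1, le_trans ?_ e2⟩
        · have := mul_le_mul_of_nonneg_left hq1 hα.le
          linarith
        · exact mul_le_of_le_one_left hp.le hq1
  obtain ⟨α, hα, p, hp, h⟩ := key 0 (Nat.zero_le _)
  exact ⟨α, hα, fun s g => (h s (fun i _ => Nat.zero_le _) g).1⟩

end NoArbitrage

/-! ### Passage to infinitely many assets -/

section Gain

variable {Ω : Type*} [MeasurableSpace Ω] {P : Measure Ω} [IsProbabilityMeasure P]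
  {ε : ℕ → Ω → ℝ}

theorem integrable_coeFn_Lp_two (f : Lp ℝ 2 P) : Integrable f P :=
  (Lp.memLp f).integrable (by norm_num)

theorem integral_abs_le_norm_Lp_two (f : Lp ℝ 2 P) : ∫ ω, |f ω| ∂P ≤ ‖f‖ := by
  have h := eLpNorm_le_eLpNorm_of_exponent_le (p := 1) (q := 2) (by norm_num)
    (Lp.memLp f).aestronglyMeasurable
  have h' := ENNReal.toReal_mono (Lp.memLp f).eLpNorm_ne_top h
  rw [Lp.norm_def]
  refine le_trans (le_of_eq ?_) h'
  rw [eLpNorm_one_eq_lintegral_enorm, ← integral_norm_eq_lintegral_enorm (Lp.memLp f).1]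
  simp

/-- Needed for the negative part, to carry the loss bound to the limit, and for the absolute value,
to control the majorant in Fatou's lemma. -/
theorem tendsto_integral_comp_of_lipschitz {φ : ℝ → ℝ} (hφ : LipschitzWith 1 φ)
    {f : ℕ → Lp ℝ 2 P} {f₀ : Lp ℝ 2 P} (hf : Tendsto f atTop (𝓝 f₀)) :
    Tendsto (fun n => ∫ ω, φ (f n ω) ∂P) atTop (𝓝 (∫ ω, φ (f₀ ω) ∂P)) := by
  have hint : ∀ u : Lp ℝ 2 P, Integrable (fun ω => φ (u ω)) P := by
    intro u
    refine ((integrable_coeFn_Lp_two u).abs.fun_add (integrable_const |φ 0|)).mono'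
      (hφ.continuous.comp_aestronglyMeasurable (Lp.aestronglyMeasurable u))
      (Eventually.of_forall fun ω => ?_)
    have := hφ.dist_le_mul (u ω) 0
    simp only [Real.dist_eq, NNReal.coe_one, one_mul, sub_zero] at this
    have h2 := abs_sub_abs_le_abs_sub (φ (u ω)) (φ 0)
    rw [Real.norm_eq_abs]
    linarith
  rw [tendsto_iff_norm_sub_tendsto_zero] at hf ⊢
  refine squeeze_zero (fun n => norm_nonneg _) (fun n => ?_) hf
  rw [← integral_sub (hint _) (hint _)]
  refine (norm_integral_le_integral_norm _).trans
    (le_trans ?_ (integral_abs_le_norm_Lp_two (f n - f₀)))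
  refine integral_mono_ae ((hint _).sub' (hint _)).norm (integrable_coeFn_Lp_two _).abs ?_
  filter_upwards [Lp.coeFn_sub (f n) f₀] with ω hω
  rw [hω]
  simpa [Real.dist_eq] using hφ.dist_le_mul (f n ω) (f₀ ω)

/-- `h ↦ ⟨h, ε - b⟩` as a continuous linear map from `ℓ²` to `L²(P)`. -/
theorem exists_gain_eq_continuousLinearMap (hε : ∀ i, MemLp (ε i) 2 P) (hind : iIndepFun ε P)
    (hmean : ∀ i, ∫ ω, ε i ω ∂P = 0) (hvar : ∀ i, ∫ ω, ε i ω ^ 2 ∂P = 1)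
    {b : ℕ → ℝ} (hb : Memℓp b 2) :
    ∃ T : ell2 →L[ℝ] Lp ℝ 2 P, ∀ h, gain hε b h = T h := by
  let S : ℕ → ell2 →L[ℝ] Lp ℝ 2 P := fun n => ∑ i ∈ Finset.range n,
    (lp.evalCLM ℝ (fun _ : ℕ => ℝ) 2 i).smulRight ((hε i).sub (memLp_const (b i))).toLp
  have hS : Tendsto (fun n h => S n h) atTop (𝓝 (gain hε b)) := by
    rw [tendsto_pi_nhds]
    intro h
    refine (tendsto_partialGain hε hind hmean hvar hb h).congr fun n => ?_
    simp only [S, partialGain, _root_.sum_apply]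
    rfl
  -- Continuity of the pointwise limit is Banach–Steinhaus.
  exact ⟨continuousLinearMapOfTendsto S hS, fun h => rfl⟩

theorem coeFn_partialGain (hε : ∀ i, MemLp (ε i) 2 P) (b : ℕ → ℝ) (h : ell2) (n : ℕ) :
    partialGain hε b h n =ᵐ[P] fun ω => ∑ i ∈ Finset.range n, h i * (ε i ω - b i) := by
  have h1 : ∀ᵐ ω ∂P, ∀ i,
      (h i • ((hε i).sub (memLp_const (b i))).toLp : Lp ℝ 2 P) ω = h i * (ε i ω - b i) := by
    rw [ae_all_iff]
    intro i
    filter_upwards [Lp.coeFn_smul (h i) ((hε i).sub (memLp_const (b i))).toLp,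
      ((hε i).sub (memLp_const (b i))).coeFn_toLp] with ω e1 e2
    rw [e1, Pi.smul_apply, e2]
    rfl
  filter_upwards [Lp.coeFn_finsetSum (Finset.range n)
    (fun i => h i • ((hε i).sub (memLp_const (b i))).toLp), h1] with ω e1 e2
  rw [partialGain, e1, Finset.sum_apply]
  exact Finset.sum_congr rfl fun i _ => e2 i

/-- The finite bound has `α` independent of the set of assets, and both of its sides converge along
the partial sums. -/
theorem exists_loss_bound (hmeas : ∀ i, Measurable (ε i)) (hε : ∀ i, MemLp (ε i) 2 P)
    (h3 : ∀ i, MemLp (ε i) 3 P) (hind : iIndepFun ε P)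
    (hmean : ∀ i, ∫ ω, ε i ω ∂P = 0) (hvar : ∀ i, ∫ ω, ε i ω ^ 2 ∂P = 1)
    {M : ℝ} (hM : ∀ i, ∫ ω, |ε i ω| ^ 3 ∂P ≤ M) {b : ℕ → ℝ} (hb : Memℓp b 2)
    (hNA : ∀ i, 0 < P {ω | b i < ε i ω} ∧ 0 < P {ω | ε i ω < b i}) :
    ∃ α > 0, ∀ h : ell2, α * ‖h‖ ≤ ∫ ω, max (-gain hε b h ω) 0 ∂P := by
  have hb2 : Summable fun i => b i ^ 2 := by simpa using hb.summable (by norm_num)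
  obtain ⟨α, hα, hbound⟩ := exists_loss_bound_finset hmeas h3 hind hmean hvar hM hb2 hNA
  refine ⟨α, hα, fun h => ?_⟩
  have hφ : LipschitzWith 1 fun x : ℝ => max (-x) 0 :=
    (LipschitzWith.id.neg).max_const 0
  have hlim := tendsto_integral_comp_of_lipschitz hφ
    (tendsto_partialGain hε hind hmean hvar hb h)
  have hnorm : Tendsto (fun n => √(∑ i ∈ Finset.range n, h i ^ 2)) atTop (𝓝 ‖h‖) := by
    have h1 := lp.hasSum_norm (p := 2) (by norm_num) h
    simp only [ENNReal.toReal_ofNat, Real.rpow_ofNat, Real.norm_eq_abs, sq_abs] at h1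
    have h2 := (Real.continuous_sqrt.tendsto _).comp h1.tendsto_sum_nat
    rwa [Real.sqrt_sq (norm_nonneg _)] at h2
  refine le_of_tendsto_of_tendsto' (hnorm.const_mul α) hlim fun n => ?_
  refine (hbound _ _).trans (le_of_eq (integral_congr_ae ?_))
  filter_upwards [coeFn_partialGain hε b h n] with ω hω
  rw [hω]

end Gain

/-! ### Maximization on a Hilbert space -/

/-- A decreasing sequence of nonempty closed convex bounded subsets of a Hilbert space has a
common point. -/
theorem nonempty_iInter_of_antitone_convex_bounded {E : Type*} [NormedAddCommGroup E]
    [InnerProductSpace ℝ E] [CompleteSpace E] {C : ℕ → Set E} (hanti : Antitone C)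
    (hne : ∀ n, (C n).Nonempty) (hcl : ∀ n, IsClosed (C n)) (hconv : ∀ n, Convex ℝ (C n))
    {R : ℝ} (hR : ∀ n, ∀ h ∈ C n, ‖h‖ ≤ R) : (⋂ n, C n).Nonempty := by
  have hmin : ∀ n, ∃ v ∈ C n, ∀ w ∈ C n, ‖v‖ ≤ ‖w‖ := by
    intro n
    obtain ⟨v, hv, hv'⟩ := exists_norm_eq_iInf_of_complete_convex (hne n) (hcl n).isComplete
      (hconv n) 0
    refine ⟨v, hv, fun w hw => ?_⟩
    simp only [zero_sub, norm_neg] at hv'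
    rw [hv']
    exact ciInf_le ⟨0, Set.forall_mem_range.2 fun _ => norm_nonneg _⟩ (⟨w, hw⟩ : C n)
  choose v hv hvmin using hmin
  have hmono : Monotone fun n => ‖v n‖ ^ 2 := fun m n hmn =>
    pow_le_pow_left₀ (norm_nonneg _) (hvmin m _ (hanti hmn (hv n))) 2
  have hbdd : BddAbove (Set.range fun n => ‖v n‖ ^ 2) := by
    refine ⟨R ^ 2, ?_⟩
    rintro _ ⟨n, rfl⟩
    exact pow_le_pow_left₀ (norm_nonneg _) (hR n _ (hv n)) 2
  have hlim := (tendsto_atTop_ciSup hmono hbdd).cauchySeq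
  -- The midpoint lies in `C m`, so its norm is at least `‖v m‖`; the parallelogram law then makes
  -- the minimal-norm points Cauchy, since their squared norms converge.
  have hkey : ∀ m n, m ≤ n → ‖v n - v m‖ ^ 2 ≤ 2 * (‖v n‖ ^ 2 - ‖v m‖ ^ 2) := by
    intro m n hmn
    have hmid : (1 / 2 : ℝ) • (v n + v m) ∈ C m := by
      rw [smul_add]
      exact hconv m (hanti hmn (hv n)) (hv m) (by norm_num) (by norm_num) (by norm_num)
    have h1 := hvmin m _ hmid
    rw [norm_smul, Real.norm_of_nonneg (by norm_num)] at h1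
    have h2 := parallelogram_law_with_norm ℝ (v n) (v m)
    nlinarith [norm_nonneg (v m), norm_nonneg (v n + v m)]
  have hcau : CauchySeq v := by
    rw [Metric.cauchySeq_iff'] at hlim ⊢
    intro δ hδ
    obtain ⟨N, hN⟩ := hlim (δ ^ 2 / 2) (by positivity)
    refine ⟨N, fun n hn => ?_⟩
    have h1 := hN n hn
    rw [Real.dist_eq] at h1
    have h2 := hkey N n hn
    rw [dist_eq_norm]
    refine lt_of_pow_lt_pow_left₀ 2 hδ.le ?_
    have := le_abs_self (‖v n‖ ^ 2 - ‖v N‖ ^ 2)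
    linarith
  obtain ⟨a, ha⟩ := cauchySeq_tendsto_of_complete hcau
  refine ⟨a, Set.mem_iInter.2 fun n => (hcl n).mem_of_tendsto ha ?_⟩
  filter_upwards [eventually_ge_atTop n] with m hm using hanti hm (hv m)

/-- A coercive functional on a Hilbert space, with closed convex superlevel sets,
attains its maximum. -/
theorem exists_forall_le_of_coercive {E : Type*} [NormedAddCommGroup E]
    [InnerProductSpace ℝ E] [CompleteSpace E] {S : Set E} {J : E → ℝ} (hS : S.Nonempty)
    (hcl : ∀ r, IsClosed {h | h ∈ S ∧ r ≤ J h}) (hconv : ∀ r, Convex ℝ {h | h ∈ S ∧ r ≤ J h})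
    {B : ℝ} (hB : ∀ h ∈ S, J h ≤ B - ‖h‖) : ∃ h ∈ S, ∀ g ∈ S, J g ≤ J h := by
  have hbdd : BddAbove (J '' S) := by
    refine ⟨B, ?_⟩
    rintro _ ⟨h, hh, rfl⟩
    linarith [hB h hh, norm_nonneg h]
  set m := sSup (J '' S) with hm
  obtain ⟨h, hh⟩ := nonempty_iInter_of_antitone_convex_bounded
    (C := fun n : ℕ => {h | h ∈ S ∧ m - 1 / ((n : ℝ) + 1) ≤ J h}) (R := B - m + 1)
    (fun k n hkn h hh => ⟨hh.1, le_trans (by gcongr) hh.2⟩)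
    (fun n => by
      obtain ⟨_, ⟨h, hh, rfl⟩, hlt⟩ := exists_lt_of_lt_csSup (hS.image J)
        (show m - 1 / ((n : ℝ) + 1) < sSup (J '' S) by
          have : 0 < 1 / ((n : ℝ) + 1) := by positivity
          linarith)
      exact ⟨h, hh, hlt.le⟩)
    (fun n => hcl _) (fun n => hconv _)
    (fun n h hh => by
      have h1 : 1 / ((n : ℝ) + 1) ≤ 1 := by
        rw [div_le_one (by positivity)]
        linarith [(Nat.cast_nonneg n : (0 : ℝ) ≤ n)]
      linarith [hB h hh.1, hh.2])
  rw [Set.mem_iInter] at hh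
  refine ⟨h, (hh 0).1, fun g hg => (le_csSup hbdd ⟨g, hg, rfl⟩).trans ?_⟩
  have hlim : Tendsto (fun n : ℕ => m - 1 / ((n : ℝ) + 1)) atTop (𝓝 (m - 0)) :=
    tendsto_const_nhds.sub tendsto_one_div_add_atTop_nhds_zero_nat
  rw [sub_zero] at hlim
  exact le_of_tendsto' hlim fun n => (hh n).2

/-! ### Growth of the utility function -/

section Utility

variable {U : ℝ → ℝ}

/-- A concave function lies below its tangent, here taken at `x₀`. -/
theorem utility_le_sub (hconc : ConcaveOn ℝ Set.univ U) (hdiff : Differentiable ℝ U)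
    {x₀ : ℝ} (hU₀ : U x₀ = 0) (hU₁ : deriv U x₀ = 1) (y : ℝ) : U y ≤ y - x₀ := by
  have hd : HasDerivAt U 1 x₀ := hU₁ ▸ (hdiff x₀).hasDerivAt
  rcases lt_trichotomy y x₀ with h | rfl | h
  · have := hconc.le_slope_of_hasDerivAt (Set.mem_univ _) (Set.mem_univ _) h hd
    rw [slope_def_field, hU₀, le_div_iff₀ (by linarith)] at this
    linarith
  · simp [hU₀]
  · have := hconc.slope_le_of_hasDerivAt (Set.mem_univ _) (Set.mem_univ _) h hd
    rw [slope_def_field, hU₀, div_le_iff₀ (by linarith)] at this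
    linarith

theorem exists_mul_le_rpow_add {β : ℝ} (hβ : 1 < β) {l : ℝ} (hl : 0 ≤ l) :
    ∃ k, ∀ w, 0 ≤ w → l * w ≤ w ^ β + k := by
  obtain ⟨a, ha⟩ := eventually_atTop.1
    ((tendsto_rpow_atTop (sub_pos.2 hβ)).eventually_ge_atTop l)
  set c := max a 1
  refine ⟨l * c, fun w hw => ?_⟩
  rcases le_total w c with h | h
  · have := mul_le_mul_of_nonneg_left h hl
    linarith [Real.rpow_nonneg hw β]
  · have hw1 : 0 < w := lt_of_lt_of_le zero_lt_one ((le_max_right a 1).trans h)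
    have h1 := mul_le_mul_of_nonneg_right (ha w ((le_max_left a 1).trans h)) hw
    rw [← Real.rpow_add_one hw1.ne', sub_add_cancel] at h1
    have : 0 ≤ l * c := mul_nonneg hl (zero_le_one.trans (le_max_right a 1))
    linarith

/-- Superlinear decay of the utility of losses. -/
theorem exists_utility_le {x₀ : ℝ} (hmono : StrictMono U) (hle : ∀ y, U y ≤ y - x₀) (hU₀ : U x₀ = 0)
    {C₁ C₂ β : ℝ} (hC₁ : 0 < C₁) (hC₂ : 0 ≤ C₂) (hβ : 1 < β)
    (hlower : ∀ y ≤ x₀, C₁ * |y| ^ β - C₂ ≤ |U y|) {l : ℝ} (hl : 0 ≤ l) :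
    ∃ k, ∀ y, U y ≤ |y| + k - l * max (-y) 0 := by
  obtain ⟨k, hk⟩ := exists_mul_le_rpow_add hβ (div_nonneg hl hC₁.le)
  have hk0 : 0 ≤ k := by
    have := hk 0 le_rfl
    rw [mul_zero, Real.zero_rpow (by linarith)] at this
    linarith
  -- The first two terms serve `y ≤ x₀`, where `C₁ * |y| ^ β` beats `l * |y|`. The last two serve `y
  -- > x₀`, where the tangent bound holds and `-y ≤ |x₀|`.
  refine ⟨C₂ + C₁ * k + |x₀| + l * |x₀|, fun y => ?_⟩
  have hC : 0 ≤ C₁ * k := mul_nonneg hC₁.le hk0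
  have hlx : 0 ≤ l * |x₀| := mul_nonneg hl (abs_nonneg _)
  rcases le_or_gt y x₀ with h | h
  · have h1 : U y ≤ 0 := hU₀ ▸ hmono.monotone h
    have h2 := hlower y h
    rw [abs_of_nonpos h1] at h2
    have h3 := mul_le_mul_of_nonneg_left (hk |y| (abs_nonneg y)) hC₁.le
    have h4 : C₁ * (l / C₁ * |y|) = l * |y| := by field_simp
    have h5 : l * max (-y) 0 ≤ l * |y| :=
      mul_le_mul_of_nonneg_left (max_le (neg_le_abs y) (abs_nonneg y)) hl
    linarith [abs_nonneg y, abs_nonneg x₀]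
  · have h1 : max (-y) 0 ≤ |x₀| := max_le (by linarith [neg_le_abs x₀]) (abs_nonneg _)
    have h2 := mul_le_mul_of_nonneg_left h1 hl
    linarith [hle y, le_abs_self y, neg_le_abs x₀]

end Utility

/-! ### Expected utility as a functional on `L²` -/

section Objective

variable {Ω : Type*} [MeasurableSpace Ω] {P : Measure Ω}
  {U : ℝ → ℝ} {G : Ω → ℝ}

theorem aestronglyMeasurable_utility (hcont : Continuous U) (hG : AEMeasurable G P) (x : ℝ)
    (f : Lp ℝ 2 P) : AEStronglyMeasurable (fun ω => U (x + f ω - G ω)) P :=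
  hcont.comp_aestronglyMeasurable
    (((Lp.aestronglyMeasurable f).const_add x).sub hG.aestronglyMeasurable)

theorem extExpectation_of_integrable {Y : Ω → ℝ} (hY : Integrable Y P) :
    extExpectation P Y = ((∫ ω, Y ω ∂P : ℝ) : EReal) := by
  have hp : Integrable (fun ω => (Y ω)⁺) P := hY.pos_part
  have hn : Integrable (fun ω => (Y ω)⁻) P := hY.neg_part
  rw [extExpectation,
    ← ofReal_integral_eq_lintegral_ofReal hp (Eventually.of_forall fun ω => posPart_nonneg _),
    ← ofReal_integral_eq_lintegral_ofReal hn (Eventually.of_forall fun ω => negPart_nonneg _),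
    EReal.coe_ennreal_ofReal, EReal.coe_ennreal_ofReal,
    max_eq_left (integral_nonneg fun ω => posPart_nonneg _),
    max_eq_left (integral_nonneg fun ω => negPart_nonneg _), ← EReal.coe_sub,
    ← integral_sub hp hn]
  simp only [posPart_sub_negPart]

variable [IsProbabilityMeasure P]

/-- The integrable majorant controls the positive part, so admissibility amounts to integrability of
the utility. -/
theorem integrable_utility_of_negPart (hcont : Continuous U) (hGm : AEMeasurable G P) {x c : ℝ}
    {f : Lp ℝ 2 P} (hc : ∀ᵐ ω ∂P, U (x + f ω - G ω) ≤ |f ω| + c)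
    (hneg : ∫⁻ ω, ENNReal.ofReal ((U (x + f ω - G ω))⁻) ∂P < ⊤) :
    Integrable (fun ω => U (x + f ω - G ω)) P := by
  have hm := aestronglyMeasurable_utility hcont hGm x f
  have hi : Integrable (fun ω => (U (x + f ω - G ω))⁻) P := by
    refine ⟨?_, (hasFiniteIntegral_iff_ofReal (Eventually.of_forall fun ω => negPart_nonneg _)).2
      hneg⟩
    simp only [negPart_def]
    exact (continuous_neg.sup continuous_const).comp_aestronglyMeasurable hm
  refine integrable_of_le_of_le hm (Eventually.of_forall fun ω => ?_) hc hi.neg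
    ((integrable_coeFn_Lp_two f).abs.fun_add (integrable_const c))
  simp only [Pi.neg_apply]
  exact neg_le.1 (neg_le_negPart _)

/-- Upper semicontinuity of the expected utility along `L²`-convergent payoffs. -/
theorem integrable_utility_of_tendsto (hcont : Continuous U) (hGm : AEMeasurable G P) {x c : ℝ}
    (hc : ∀ f : Lp ℝ 2 P, ∀ᵐ ω ∂P, U (x + f ω - G ω) ≤ |f ω| + c)
    {f : ℕ → Lp ℝ 2 P} {f₀ : Lp ℝ 2 P} (hf : Tendsto f atTop (𝓝 f₀)) {r : ℝ}
    (hint : ∀ n, Integrable (fun ω => U (x + f n ω - G ω)) P)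
    (hr : ∀ n, r ≤ ∫ ω, U (x + f n ω - G ω) ∂P) :
    Integrable (fun ω => U (x + f₀ ω - G ω)) P ∧ r ≤ ∫ ω, U (x + f₀ ω - G ω) ∂P := by
  obtain ⟨ns, hns, hae⟩ := (tendstoInMeasure_of_tendsto_Lp hf).exists_seq_tendsto_ae
  have hm := aestronglyMeasurable_utility hcont hGm x
  have habs : ∀ u : Lp ℝ 2 P, Integrable (fun ω => |u ω| + c) P := fun u =>
    (integrable_coeFn_Lp_two u).abs.fun_add (integrable_const c)
  have hnn : ∀ u : Lp ℝ 2 P, 0 ≤ᵐ[P] fun ω => |u ω| + c - U (x + u ω - G ω) := fun u => by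
    filter_upwards [hc u] with ω hω using sub_nonneg.2 hω
  have hlim : Tendsto (fun n => ∫ ω, |f (ns n) ω| ∂P + c - r) atTop
      (𝓝 (∫ ω, |f₀ ω| ∂P + c - r)) :=
    (((tendsto_integral_comp_of_lipschitz (φ := fun y => |y|) lipschitzWith_one_norm hf).comp
      hns.tendsto_atTop).add_const c).sub_const r
  have hle : ∀ n, ∫ ω, (|f n ω| + c - U (x + f n ω - G ω)) ∂P ≤ ∫ ω, |f n ω| ∂P + c - r := by
    intro n
    rw [integral_sub (habs _) (hint n),
      integral_add (integrable_coeFn_Lp_two _).abs (integrable_const c)]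
    simp only [integral_const, probReal_univ, one_smul]
    linarith [hr n]
  -- `ENNReal.ofReal` truncates at zero; nonnegativity allows the Fatou estimate to be read back in
  -- the reals.
  have hD : 0 ≤ ∫ ω, |f₀ ω| ∂P + c - r :=
    ge_of_tendsto' hlim fun n => (integral_nonneg_of_ae (hnn _)).trans (hle _)
  -- Fatou is applied to the nonnegative gap between majorant and utility along an a.e. convergent
  -- subsequence; the majorants' integrals converge, leaving upper semicontinuity of the utility
  -- term.
  have hfatou : ∫⁻ ω, ENNReal.ofReal (|f₀ ω| + c - U (x + f₀ ω - G ω)) ∂P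
      ≤ ENNReal.ofReal (∫ ω, |f₀ ω| ∂P + c - r) := by
    calc ∫⁻ ω, ENNReal.ofReal (|f₀ ω| + c - U (x + f₀ ω - G ω)) ∂P
        = ∫⁻ ω, liminf (fun n => ENNReal.ofReal
            (|f (ns n) ω| + c - U (x + f (ns n) ω - G ω))) atTop ∂P := by
          refine lintegral_congr_ae ?_
          filter_upwards [hae] with ω hω
          refine (Tendsto.liminf_eq (ENNReal.tendsto_ofReal ?_)).symm
          exact ((hω.abs).add_const c).sub
            ((hcont.tendsto _).comp ((hω.const_add x).sub_const (G ω)))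
      _ ≤ liminf (fun n => ∫⁻ ω, ENNReal.ofReal
            (|f (ns n) ω| + c - U (x + f (ns n) ω - G ω)) ∂P) atTop :=
          lintegral_liminf_le' fun n =>
            (((habs _).1.sub (hm _)).aemeasurable).ennreal_ofReal
      _ ≤ liminf (fun n => ENNReal.ofReal (∫ ω, |f (ns n) ω| ∂P + c - r)) atTop := by
          refine liminf_le_liminf (Eventually.of_forall fun n => ?_)
          rw [← ofReal_integral_eq_lintegral_ofReal ((habs _).sub' (hint _)) (hnn _)]
          exact ENNReal.ofReal_le_ofReal (hle _)
      _ = _ := (ENNReal.tendsto_ofReal hlim).liminf_eq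
  have hdiff : Integrable (fun ω => |f₀ ω| + c - U (x + f₀ ω - G ω)) P :=
    ⟨(habs _).1.sub (hm _),
      (hasFiniteIntegral_iff_ofReal (hnn f₀)).2 (hfatou.trans_lt ENNReal.ofReal_lt_top)⟩
  have hU : Integrable (fun ω => U (x + f₀ ω - G ω)) P := by
    simpa using (habs f₀).sub' hdiff
  refine ⟨hU, ?_⟩
  rw [← ofReal_integral_eq_lintegral_ofReal hdiff (hnn f₀), ENNReal.ofReal_le_ofReal_iff hD,
    integral_sub (habs _) hU,
    integral_add (integrable_coeFn_Lp_two _).abs (integrable_const c)] at hfatou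
  simp only [integral_const, probReal_univ, one_smul] at hfatou
  linarith

/-- Convexity of the superlevel sets of the expected utility. -/
theorem convex_utility_superlevel (hconc : ConcaveOn ℝ Set.univ U) (hcont : Continuous U)
    (hGm : AEMeasurable G P) {x c : ℝ}
    (hc : ∀ f : Lp ℝ 2 P, ∀ᵐ ω ∂P, U (x + f ω - G ω) ≤ |f ω| + c) (r : ℝ) :
    Convex ℝ {f : Lp ℝ 2 P | Integrable (fun ω => U (x + f ω - G ω)) P ∧
      r ≤ ∫ ω, U (x + f ω - G ω) ∂P} := by
  rintro f ⟨hf, hfr⟩ g ⟨hg, hgr⟩ s t hs ht hst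
  -- Besides the inequality of integrals, this minorant gives integrability at the convex
  -- combination, by squeezing against the majorant.
  have hlow : (fun ω => s * U (x + f ω - G ω) + t * U (x + g ω - G ω))
      ≤ᵐ[P] fun ω => U (x + (s • f + t • g : Lp ℝ 2 P) ω - G ω) := by
    filter_upwards [Lp.coeFn_add (s • f) (t • g), Lp.coeFn_smul s f, Lp.coeFn_smul t g]
      with ω h1 h2 h3
    rw [h1, Pi.add_apply, h2, h3, Pi.smul_apply, Pi.smul_apply]
    have := hconc.2 (Set.mem_univ (x + f ω - G ω)) (Set.mem_univ (x + g ω - G ω)) hs ht hst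
    simp only [smul_eq_mul] at this ⊢
    refine this.trans (le_of_eq (congrArg U ?_))
    linear_combination (x - G ω) * hst
  have hli : Integrable (fun ω => s * U (x + f ω - G ω) + t * U (x + g ω - G ω)) P :=
    (hf.const_mul s).fun_add (hg.const_mul t)
  have hi : Integrable (fun ω => U (x + (s • f + t • g : Lp ℝ 2 P) ω - G ω)) P :=
    integrable_of_le_of_le (aestronglyMeasurable_utility hcont hGm x _) hlow (hc _) hli
      ((integrable_coeFn_Lp_two _).abs.fun_add (integrable_const c))
  refine ⟨hi, le_trans ?_ (integral_mono_ae hli hi hlow)⟩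
  rw [integral_add (hf.const_mul s) (hg.const_mul t), integral_const_mul, integral_const_mul]
  have h1 := mul_le_mul_of_nonneg_left hfr hs
  have h2 := mul_le_mul_of_nonneg_left hgr ht
  have h3 : s * r + t * r = r := by rw [← add_mul, hst, one_mul]
  linarith

end Objective

end APT

/-! ### Existence of the optimal strategy -/

theorem theorem3p1
    {Ω : Type*} [MeasurableSpace Ω] (P : Measure Ω) [IsProbabilityMeasure P]
    -- the factors: independent, square-integrable, centred, with unit variance
    (ε : ℕ → Ω → ℝ) (hmeas : ∀ i, Measurable (ε i)) (hε : ∀ i, MemLp (ε i) 2 P)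
    (hind : iIndepFun ε P)
    (hmean : ∀ i, ∫ ω, ε i ω ∂P = 0) (hvar : ∀ i, ∫ ω, ε i ω ^ 2 ∂P = 1)
    -- `b ∈ ℓ²`, no arbitrage in each asset, bounded third moments
    (b : ℕ → ℝ) (hb : Memℓp b 2)
    (hNA : ∀ i, 0 < P {ω | b i < ε i ω} ∧ 0 < P {ω | ε i ω < b i})
    (hthird : (⨆ i, ∫⁻ ω, ENNReal.ofReal (|ε i ω| ^ 3) ∂P) < ⊤)
    -- the utility function
    (U : ℝ → ℝ) (hconc : ConcaveOn ℝ Set.univ U) (hmono : StrictMono U)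
    (hdiff : Differentiable ℝ U)
    (x₀ : ℝ) (hU₀ : U x₀ = 0) (hU₁ : deriv U x₀ = 1)
    (C₁ C₂ C₃ C₄ β γ : ℝ) (hC₁ : 0 < C₁) (hC₂ : 0 ≤ C₂) (hC₃ : 0 < C₃) (hC₄ : 0 ≤ C₄)
    (hβ : 1 < β) (hlower : ∀ y ≤ x₀, C₁ * |y| ^ β - C₂ ≤ |U y|)
    (hγ : min β 2 ≤ γ) (hupper : ∀ y : ℝ, (U y)⁻ ≤ C₃ * |y| ^ γ + C₄)
    (hmoment : (⨆ i, ∫⁻ ω, ENNReal.ofReal (|ε i ω| ^ γ) ∂P) < ⊤)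
    -- the claim
    (G : Ω → ℝ) (hGmeas : AEMeasurable G P) (hG : ∀ᵐ ω ∂P, 0 ≤ G ω)
    (hGint : ∀ y : ℝ, Integrable (fun ω => U (y - G ω)) P)
    (x : ℝ) :
    ∃ hstar ∈ APT.admissible hε b U G x,
      Integrable (fun ω => U (APT.wealth hε b x hstar ω - G ω)) P ∧
      APT.maxUtility hε b U G x =
        ((∫ ω, U (APT.wealth hε b x hstar ω - G ω) ∂P : ℝ) : EReal) := by
  have hpow : ∀ i ω, ENNReal.ofReal (|ε i ω| ^ 3) = ‖ε i ω‖ₑ ^ 3 := fun i ω => by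
    rw [ENNReal.ofReal_pow (abs_nonneg _), ← Real.norm_eq_abs, ofReal_norm]
  have hthird' : ∀ i, ∫⁻ ω, ENNReal.ofReal (|ε i ω| ^ 3) ∂P < ⊤ := fun i =>
    (le_iSup (fun i => ∫⁻ ω, ENNReal.ofReal (|ε i ω| ^ 3) ∂P) i).trans_lt hthird
  have h3 : ∀ i, MemLp (ε i) 3 P := fun i => by
    refine ⟨(hmeas i).aestronglyMeasurable, ?_⟩
    rw [eLpNorm_lt_top_iff_lintegral_rpow_enorm_lt_top (by norm_num) (by norm_num)]
    simpa [hpow] using hthird' i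
  obtain ⟨M, hM⟩ : ∃ M, ∀ i, ∫ ω, |ε i ω| ^ 3 ∂P ≤ M := by
    refine ⟨(⨆ i, ∫⁻ ω, ENNReal.ofReal (|ε i ω| ^ 3) ∂P).toReal, fun i => ?_⟩
    rw [integral_eq_lintegral_of_nonneg_ae (Eventually.of_forall fun ω => by positivity)
      (APT.integrable_abs_pow_three (h3 i)).1]
    exact ENNReal.toReal_mono hthird.ne
      (le_iSup (fun i => ∫⁻ ω, ENNReal.ofReal (|ε i ω| ^ 3) ∂P) i)
  obtain ⟨α, hα, hloss⟩ := APT.exists_loss_bound hmeas hε h3 hind hmean hvar hM hb hNA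
  obtain ⟨T, hT⟩ := APT.exists_gain_eq_continuousLinearMap hε hind hmean hvar hb
  have hcont : Continuous U := hdiff.continuous
  have hle : ∀ y, U y ≤ y - x₀ := APT.utility_le_sub hconc hdiff hU₀ hU₁
  have hc : ∀ f : Lp ℝ 2 P, ∀ᵐ ω ∂P, U (x + f ω - G ω) ≤ |f ω| + (|x| + |x₀|) := fun f => by
    filter_upwards [hG] with ω hω
    linarith [hle (x + f ω - G ω), le_abs_self (f ω), le_abs_self x, neg_le_abs x₀]
  have hwealth : ∀ h ω, APT.wealth hε b x h ω = x + T h ω := fun h ω => by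
    rw [APT.wealth, hT]
  have hadm : ∀ h, h ∈ APT.admissible hε b U G x ↔
      Integrable (fun ω => U (x + T h ω - G ω)) P := by
    intro h
    simp only [APT.admissible, Set.mem_ofPred_eq, hwealth]
    refine ⟨fun hh => APT.integrable_utility_of_negPart hcont hGmeas (hc _) hh, fun hh => ?_⟩
    exact (hasFiniteIntegral_iff_ofReal (Eventually.of_forall fun ω => negPart_nonneg _)).1
      (show Integrable (fun ω => (U (x + T h ω - G ω))⁻) P from hh.neg_part).2
  set S : Set APT.ell2 := {h | Integrable (fun ω => U (x + T h ω - G ω)) P} with hSdef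
  set J : APT.ell2 → ℝ := fun h => ∫ ω, U (x + T h ω - G ω) ∂P with hJ
  have hne : S.Nonempty := by
    refine ⟨0, (hGint x).congr ?_⟩
    filter_upwards [Lp.coeFn_zero ℝ 2 P] with ω hω
    rw [map_zero, hω, Pi.zero_apply, add_zero]
  have hconv : ∀ r, Convex ℝ {h | h ∈ S ∧ r ≤ J h} := fun r =>
    (APT.convex_utility_superlevel hconc hcont hGmeas hc r).linear_preimage T.toLinearMap
  have hcl : ∀ r, IsClosed {h | h ∈ S ∧ r ≤ J h} := fun r => by
    refine IsSeqClosed.isClosed fun u h hu hlim => ?_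
    exact APT.integrable_utility_of_tendsto hcont hGmeas hc ((T.continuous.tendsto h).comp hlim)
      (fun n => (hu n).1) (fun n => (hu n).2)
  obtain ⟨B, hB⟩ : ∃ B, ∀ h ∈ S, J h ≤ B - ‖h‖ := by
    -- With this slope `l * α - ‖T‖ = 1`, so the expected losses outweigh `E |T h|` by exactly
    -- `‖h‖`.
    set l := (‖T‖ + 1) / α with hl
    have hl0 : 0 ≤ l := by positivity
    obtain ⟨k, hk⟩ := APT.exists_utility_le hmono hle hU₀ hC₁ hC₂ hβ hlower hl0
    refine ⟨|x| + k + l * |x|, fun h hh => ?_⟩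
    have hi := APT.integrable_coeFn_Lp_two (T h)
    have hn : Integrable (fun ω => max (-T h ω) 0) P := hi.neg.pos_part
    -- The claim is dropped by monotonicity of `U`; `|x|` and `l * |x|` pay for removing `x` from
    -- the absolute value and from the negative part.
    have hpt : ∀ᵐ ω ∂P, U (x + T h ω - G ω) ≤
        |T h ω| + (|x| + k + l * |x|) - l * max (-T h ω) 0 := by
      filter_upwards [hG] with ω hω
      have h1 : U (x + T h ω - G ω) ≤ U (x + T h ω) := hmono.monotone (by linarith)
      have h2 := hk (x + T h ω)
      have h3 : max (-T h ω) 0 ≤ max (-(x + T h ω)) 0 + |x| :=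
        max_le (by linarith [le_max_left (-(x + T h ω)) 0, le_abs_self x])
          (add_nonneg (le_max_right _ _) (abs_nonneg _))
      have h4 := mul_le_mul_of_nonneg_left h3 hl0
      linarith [abs_add_le x (T h ω)]
    have hint := integral_mono_ae hh
      ((hi.abs.fun_add (integrable_const (|x| + k + l * |x|))).sub' (hn.const_mul l)) hpt
    rw [integral_sub (hi.abs.fun_add (integrable_const _)) (hn.const_mul l),
      integral_add hi.abs (integrable_const _), integral_const_mul] at hint
    simp only [integral_const, probReal_univ, one_smul] at hint
    have h1 := (APT.integral_abs_le_norm_Lp_two (T h)).trans (T.le_opNorm h)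
    have h2 := hloss h
    rw [hT] at h2
    have h3 := mul_le_mul_of_nonneg_left h2 hl0
    have h4 : l * (α * ‖h‖) = (‖T‖ + 1) * ‖h‖ := by
      rw [hl]
      field_simp
    change ∫ ω, U (x + T h ω - G ω) ∂P ≤ _
    linarith
  obtain ⟨h, hh, hmax⟩ := APT.exists_forall_le_of_coercive hne hcl hconv hB
  refine ⟨h, (hadm h).2 hh, by simp only [hwealth]; exact hh, ?_⟩
  rw [APT.maxUtility]
  simp only [hwealth]
  refine le_antisymm (iSup₂_le fun g hg => ?_) ?_
  · have hg' := (hadm g).1 hg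
    rw [APT.extExpectation_of_integrable hg']
    exact EReal.coe_le_coe_iff.2 (hmax g hg')
  · rw [← APT.extExpectation_of_integrable hh]
    exact le_iSup₂ (f := fun g (_ : g ∈ APT.admissible hε b U G x) =>
      APT.extExpectation P fun ω => U (x + T g ω - G ω)) h ((hadm h).2 hh)
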